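/- For $m\in\mathbb N$ and $\rho\in\mathbb N^m$ let $W_\rho^{m}=\bigcup_{i=1}^{m}\{n\in\mathbb Z^m : n_i\in\rho_i\mathbb Z\}$ (so $W^0_\rho=\emptyset$). Let $d_1\ge 0$, $d_2\ge 2$, $d=d_1+d_2$, let $\rho=(\rho_1,\dots,\rho_{d_1})$ be integers with all $\rho_i\ge 2$, and let $\Gamma=W_\rho^{d_1}\times\mathbb Z^{d_2}\subset\mathbb Z^d$. Let $V:\mathbb Z^d\to\mathbb R$ be any bounded function with $V(n)=0$ for all $n\notin\Gamma$, and let $H=H_0+V$ on $\ell^2(\mathbb Z^d)$, where $(H_0u)(n)=\sum_{i=1}^{d}\bigl(u(n+e_i)+u(n-e_i)\bigr)$. For $q\in\mathbb R$, $k\in\mathbb Z^d$ and $T>0$ put $$\mathcal M_{q;k}(T)=\frac1T\int_0^\infty e^{-t/T}\,\langle\delta_k,e^{iHt}\langle X\rangle^{q}e^{-iHt}\delta_k\rangle\,dt=\frac1T\int_0^\infty e^{-t/T}\sum_{n\in\mathbb Z^d}\langle n\rangle^q\,\bigl|(e^{-iHt}\delta_k)(n)\bigr|^2\,dt ,$$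 where $\langle n\rangle=(1+|n|^2)^{1/2}$, $|n|=\max_\nu|n_\nu|$, and $\delta_k$ is the unit vector at $k$. Then there is a point $n_0\in\Gamma^c=\mathbb Z^d\setminus\Gamma$ such that: 1. for every real $q>d_1+1$ there is a constant $C>0$ with $\mathcal M_{q;n_0}(T)\ge C\,T$ for all $T>0$; 2. for every real $q$ with $d_1<q<d_1+1$ and every $\varepsilon$ with $0<\varepsilon<q-d_1$ there is a constant $C>0$ with $\mathcal M_{q;n_0}(T)\ge C\,T^{\,q-d_1-\varepsilon}$ for all $T>0$. -/

import Mathlib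

open MeasureTheory Set
open scoped ENNReal

noncomputable section

namespace TrimmedSchrodinger

/-- The lattice `ℤ^d`. Its Mathlib norm `‖n‖` is the maximum norm `max_ν |n_ν|`. -/
abbrev Zd (d : ℕ) : Type := Fin d → ℤ

/-- The Hilbert space `ℓ²(ℤ^d)` of square-summable complex functions. -/
abbrev L2 (d : ℕ) : Type := lp (fun _ : Zd d => ℂ) 2

variable {d : ℕ}

theorem memLp_two_iff (f : Zd d → ℂ) : Memℓp f 2 ↔ Summable fun n => ‖f n‖ ^ 2 := by
  rw [memℓp_gen_iff (by norm_num)]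
  simp

theorem norm_sq_eq_tsum (u : L2 d) : ‖u‖ ^ 2 = ∑' n, ‖u n‖ ^ 2 := by
  have h := lp.norm_rpow_eq_tsum (p := 2) (by norm_num) u
  simpa using h

/-- The translation `(S_j u)(n) = u(n + j)` on `ℓ²(ℤ^d)`. -/
def shift (j : Zd d) : L2 d →L[ℂ] L2 d :=
  LinearMap.mkContinuous
    { toFun := fun u => ⟨fun n => u (n + j), (memLp_two_iff _).2
        (((memLp_two_iff _).1 (lp.memℓp u)).comp_injective (add_left_injective j))⟩
      map_add' := fun _ _ => rfl
      map_smul' := fun _ _ => rfl }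
    1 (fun u => by
      refine le_of_sq_le_sq ?_ (by positivity)
      rw [one_mul, norm_sq_eq_tsum, norm_sq_eq_tsum]
      exact le_of_eq ((Equiv.addRight j).tsum_eq (fun n => ‖u n‖ ^ 2)))

@[simp] theorem shift_apply (j : Zd d) (u : L2 d) (n : Zd d) :
    shift j u n = u (n + j) := rfl

/-- The discrete Laplacian `(H₀ u)(n) = ∑ u(n + j)`, the sum over the `2d` nearest neighbours
`j = ± e_i` of the origin. -/
def laplacian (d : ℕ) : L2 d →L[ℂ] L2 d :=
  ∑ i : Fin d, (shift (Pi.single i 1) + shift (-Pi.single i 1))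

/-- Multiplication by a bounded real function `V` on `ℓ²(ℤ^d)`. -/
def potential (V : Zd d → ℝ) (hV : ∃ B : ℝ, ∀ n, |V n| ≤ B) : L2 d →L[ℂ] L2 d :=
  LinearMap.mkContinuousOfExistsBound
    { toFun := fun u => ⟨fun n => (V n : ℂ) * u n, by
        obtain ⟨B, hB⟩ := hV
        refine (memLp_two_iff _).2 (Summable.of_nonneg_of_le (fun _ => by positivity) (fun n => ?_)
          (((memLp_two_iff _).1 (lp.memℓp u)).mul_left (B ^ 2)))
        rw [norm_mul, mul_pow, Complex.norm_real, Real.norm_eq_abs]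
        gcongr
        exact hB n⟩
      map_add' := fun u v => by ext n; exact mul_add _ _ _
      map_smul' := fun c u => by ext n; simp [mul_left_comm] }
    (by
      obtain ⟨B, hB⟩ := hV
      have hB0 : 0 ≤ B := (abs_nonneg _).trans (hB 0)
      refine ⟨B, fun u => le_of_sq_le_sq ?_ (by positivity)⟩
      have hu := (memLp_two_iff _).1 (lp.memℓp u)
      rw [mul_pow, norm_sq_eq_tsum, norm_sq_eq_tsum, ← tsum_mul_left]
      have key : ∀ n, ‖(V n : ℂ) * u n‖ ^ 2 ≤ B ^ 2 * ‖u n‖ ^ 2 := fun n => by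
        rw [norm_mul, mul_pow, Complex.norm_real, Real.norm_eq_abs]
        gcongr
        exact hB n
      exact Summable.tsum_le_tsum key
        (Summable.of_nonneg_of_le (fun _ => by positivity) key (hu.mul_left _)) (hu.mul_left _))

@[simp] theorem potential_apply (V : Zd d → ℝ) (hV : ∃ B : ℝ, ∀ n, |V n| ≤ B) (u : L2 d)
    (n : Zd d) : potential V hV u n = (V n : ℂ) * u n := rfl

/-- The Schrödinger operator `H = H₀ + V` with bounded real potential `V`. -/
def schrodinger (V : Zd d → ℝ) (hV : ∃ B : ℝ, ∀ n, |V n| ≤ B) : L2 d →L[ℂ] L2 d :=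
  laplacian d + potential V hV

theorem schrodinger_apply (V : Zd d → ℝ) (hV : ∃ B : ℝ, ∀ n, |V n| ≤ B) (u : L2 d)
    (n : Zd d) : schrodinger V hV u n =
      (∑ i : Fin d, (u (n + Pi.single i 1) + u (n - Pi.single i 1))) + (V n : ℂ) * u n := by
  have h : laplacian d u n = ∑ i : Fin d, (u (n + Pi.single i 1) + u (n - Pi.single i 1)) := by
    rw [laplacian, sum_apply, lp.coeFn_sum, Finset.sum_apply]
    rfl
  rw [← h]
  rfl

/-- The unit vector `δ_k ∈ ℓ²(ℤ^d)`. -/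
def delta (k : Zd d) : L2 d := lp.single 2 k (1 : ℂ)

/-- The propagator `e^{-itH}` of a bounded operator, by the exponential power series. -/
def propagator (H : L2 d →L[ℂ] L2 d) (t : ℝ) : L2 d →L[ℂ] L2 d :=
  NormedSpace.exp ((-(Complex.I * (t : ℂ))) • H)

/-- The quadratic form `⟨u, φ(X) u⟩ = ∑_n φ(n) |u(n)|²` of multiplication by a nonnegative
function `φ`, with value `∞` where the series diverges. -/
def positionForm (φ : Zd d → ℝ) (u : L2 d) : ℝ≥0∞ :=
  ∑' n, ENNReal.ofReal (φ n * ‖u n‖ ^ 2)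

/-- The transport function
`𝓜_{φ;k}(T) = (1/T) ∫₀^∞ e^{-t/T} ⟨δ_k, e^{iHt} φ(X) e^{-iHt} δ_k⟩ dt`, where for the
self-adjoint `H` the integrand is the form of `φ(X)` at `e^{-iHt} δ_k`. -/
def transport (H : L2 d →L[ℂ] L2 d) (φ : Zd d → ℝ) (k : Zd d) (T : ℝ) : ℝ≥0∞ :=
  ENNReal.ofReal (1 / T) *
    ∫⁻ t in Ioi (0 : ℝ), ENNReal.ofReal (Real.exp (-t / T)) *
      positionForm φ (propagator H t (delta k))

/-- `⟨n⟩ = (1 + |n|²)^{1/2}`, with the maximum norm. -/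
def bracket (n : Zd d) : ℝ := Real.sqrt (1 + ‖n‖ ^ 2)

/-- The moment `𝓜_{q;k}(T)`, the transport function for `φ(n) = ⟨n⟩^q`. -/
def moment (H : L2 d →L[ℂ] L2 d) (q : ℝ) (k : Zd d) (T : ℝ) : ℝ≥0∞ :=
  transport H (fun n => bracket n ^ q) k T

/-- The hyperplanes `{n ∈ ℤ^m | n_i ∈ pℤ}`. -/
def hyperplanes {m : ℕ} (i : Fin m) (p : ℕ) : Set (Zd m) := {n | (p : ℤ) ∣ n i}

/-- The grid `W_ρ^m = ⋃_i {n ∈ ℤ^m | n_i ∈ ρ_i ℤ}`. -/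
def grid {m : ℕ} (ρ : Fin m → ℕ) : Set (Zd m) := ⋃ i, hyperplanes i (ρ i)

/-- `Γ = W_ρ^{d₁} × ℤ^{d₂}` in `ℤ^{d₁ + d₂}`: the first `d₁` coordinates lie in the grid. -/
def gridSet {d₁ : ℕ} (d₂ : ℕ) (ρ : Fin d₁ → ℕ) : Set (Zd (d₁ + d₂)) :=
  {n | (fun i : Fin d₁ => n (Fin.castAdd d₂ i)) ∈ grid ρ}

/-- The operator `H₀ + V` is `Γ`-trimmed: `V` vanishes off `Γ`. -/
def IsTrimmed (Γ : Set (Zd d)) (V : Zd d → ℝ) : Prop := ∀ n, n ∉ Γ → V n = 0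

end TrimmedSchrodinger

end

open MeasureTheory Set
open scoped ENNReal

noncomputable section

namespace TrimmedSchrodinger

/-! ### Bounded families as operators on `ℓ¹`, and intertwining of exponentials -/

section EllOne

variable {ι F G : Type*} [NormedAddCommGroup F] [NormedSpace ℂ F]
  [NormedAddCommGroup G] [NormedSpace ℂ G]

/-! The product of sines `s(a) = ∏ sin(π a_i / ρ_i)` vanishes on the grid and is an eigenfunction of
the Laplacian in the first `d₁` variables, with eigenvalue `E`. Since `V` lives on `Γ`, where `s` is
zero, contracting against `s` in those variables turns `H` into the free operator `K = Δ + E` on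
`ℓ²(ℤ^{d₂})` (`hop_gridState`). The contraction is defined on `ℓ¹`, so the evolution is run there.

Hence, with `u_t = e^{-itH} δ_{n₀}` and `g_t = e^{-itK} g`, the pairing of `u_t` with `s ⊗ g_t` does
not depend on `t` (`hasSum_overlap`). For `g = [X_j, Δ] δ_0` and `n₀ = (1, …, 1; e_j)` it equals
`s(1, …, 1) > 0`. This `g` gives decay: `[X_j, K]` commutes with `K`, so `X_j e^{-itK} δ_0 = -it
g_t` (`position_exp`), and `∑ ⟨m⟩^{-s} |g_t(m)|²` is `O((1+t)^{-s})` for `0 ≤ s ≤ 2`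
(`positionForm_propagator_dipole_le`).

Weighting the constant pairing by `⟨n⟩^{±q}` with `q > d₁ + s`, where `∑_a ⟨a⟩^{-(q-s)}` converges
over `ℤ^{d₁}`, forces the `q`-th moment of `u_t` to be at least a multiple of `(1+t)^s`
(`exists_rpow_le_positionForm`). Time averaging keeps the power. -/

theorem summable_norm_ellOne (u : lp (fun _ : ι => ℂ) 1) : Summable fun n => ‖u n‖ := by
  simpa using (memℓp_gen_iff (p := 1) (by norm_num)).1 (lp.memℓp u)

theorem norm_ellOne_eq_tsum (u : lp (fun _ : ι => ℂ) 1) : ‖u‖ = ∑' n, ‖u n‖ := by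
  simpa using lp.norm_rpow_eq_tsum (p := 1) (by norm_num) u

theorem summable_norm_smul (e : ι → F) {C : ℝ} (he : ∀ n, ‖e n‖ ≤ C)
    (u : lp (fun _ : ι => ℂ) 1) : Summable fun n => ‖u n • e n‖ :=
  Summable.of_nonneg_of_le (fun _ => norm_nonneg _)
    (fun n => by
      rw [norm_smul]
      exact mul_le_mul_of_nonneg_left (he n) (norm_nonneg _))
    ((summable_norm_ellOne u).mul_right C)

theorem ellOne_ext [DecidableEq ι] {S T : lp (fun _ : ι => ℂ) 1 →L[ℂ] F}
    (h : ∀ k, S (lp.single 1 k (1 : ℂ)) = T (lp.single 1 k (1 : ℂ))) : S = T := by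
  refine lp.ext_continuousLinearMap (by norm_num) fun k => ?_
  ext
  simpa using h k

variable [CompleteSpace F]

/-- The continuous linear extension to `ℓ¹` of a bounded family of vectors. -/
def ellOneLift (e : ι → F) {C : ℝ} (he : ∀ n, ‖e n‖ ≤ C) : lp (fun _ : ι => ℂ) 1 →L[ℂ] F :=
  LinearMap.mkContinuous
    { toFun := fun u => ∑' n, u n • e n
      map_add' := fun u v => by
        rw [← ((summable_norm_smul e he u).of_norm).tsum_add (summable_norm_smul e he v).of_norm]
        exact tsum_congr fun n => add_smul _ _ _
      map_smul' := fun c u => by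
        rw [RingHom.id_apply, ← ((summable_norm_smul e he u).of_norm).tsum_const_smul]
        exact tsum_congr fun n => mul_smul _ _ _ }
    C (fun u => by
      have h := summable_norm_smul e he u
      refine (norm_tsum_le_tsum_norm h).trans ?_
      rw [norm_ellOne_eq_tsum, ← tsum_mul_left]
      refine h.tsum_le_tsum (fun n => ?_) ((summable_norm_ellOne u).mul_left C)
      rw [norm_smul, mul_comm]
      exact mul_le_mul_of_nonneg_right (he n) (norm_nonneg _))

theorem hasSum_ellOneLift (e : ι → F) {C : ℝ} (he : ∀ n, ‖e n‖ ≤ C)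
    (u : lp (fun _ : ι => ℂ) 1) : HasSum (fun n => u n • e n) (ellOneLift e he u) :=
  (summable_norm_smul e he u).of_norm.hasSum

theorem ellOneLift_single [DecidableEq ι] (e : ι → F) {C : ℝ} (he : ∀ n, ‖e n‖ ≤ C) (k : ι) :
    ellOneLift e he (lp.single 1 k (1 : ℂ)) = e k := by
  refine (hasSum_ellOneLift e he _).unique ?_
  convert! hasSum_ite_eq k (e k) using 1
  ext n
  rcases eq_or_ne n k with rfl | h
  · simp
  · simp [h]

theorem exp_smul_intertwine {A : F →L[ℂ] F} {B : G →L[ℂ] G} [CompleteSpace G]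
    (T : F →L[ℂ] G)
    (h : T ∘L A = B ∘L T) (c : ℂ) (u : F) :
    T (NormedSpace.exp (c • A) u) = NormedSpace.exp (c • B) (T u) := by
  have hpow : ∀ n : ℕ, T (((c • A) ^ n) u) = ((c • B) ^ n) (T u) := by
    intro n
    induction n generalizing u with
    | zero => simp
    | succ n ih =>
      rw [pow_succ, pow_succ, mul_apply_eq_comp, ih, mul_apply_eq_comp]
      have := congrArg (fun f => f u) h
      simp only [ContinuousLinearMap.comp_apply] at this
      simp [this]
  have hA := ((NormedSpace.exp_series_hasSum_exp' (𝕂 := ℂ) (c • A)).mapL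
    (ContinuousLinearMap.apply ℂ F u)).mapL T
  have hB := (NormedSpace.exp_series_hasSum_exp' (𝕂 := ℂ) (c • B)).mapL
    (ContinuousLinearMap.apply ℂ G (T u))
  refine hA.unique ?_
  convert! hB using 2 with n
  simp only [ContinuousLinearMap.apply_apply, map_smul, hpow]

end EllOne

/-! ### The weight `⟨n⟩` and its summability -/

theorem one_le_bracket {d : ℕ} (n : Zd d) : 1 ≤ bracket n :=
  Real.one_le_sqrt.2 (by nlinarith [sq_nonneg ‖n‖])

theorem bracket_pos {d : ℕ} (n : Zd d) : 0 < bracket n := one_pos.trans_le (one_le_bracket n)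

theorem norm_le_bracket {d : ℕ} (n : Zd d) : ‖n‖ ≤ bracket n :=
  Real.le_sqrt_of_sq_le (by linarith)

theorem bracket_mono {d e : ℕ} {n : Zd d} {m : Zd e} (h : ‖n‖ ≤ ‖m‖) : bracket n ≤ bracket m :=
  Real.sqrt_le_sqrt (by gcongr)

theorem summable_norm_rpow_neg {d : ℕ} {r : ℝ} (hr : (d : ℝ) < r) :
    Summable fun n : Zd d => ‖n‖ ^ (-r) := by
  classical
  let b := Pi.basisFun ℝ (Fin d)
  let L := Submodule.span ℤ (Set.range b)
  have hrank : Module.finrank ℤ L = d := by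
    rw [ZLattice.rank ℝ L]
    simp
  have hs := ZLattice.summable_norm_rpow L (-r) (by rw [hrank]; linarith)
  let φ : Zd d → L := fun n => ⟨fun i => (n i : ℝ), by
    refine (Module.Basis.mem_span_iff_repr_mem ℤ b _).2 fun i => ⟨n i, ?_⟩
    simp [b]⟩
  have hφ : Function.Injective φ := fun n m h => by
    ext i
    have h' : (n i : ℝ) = m i := congrFun (congrArg Subtype.val h) i
    exact_mod_cast h'
  have hn : ∀ n, ‖φ n‖ = ‖n‖ := fun n => by
    change ‖fun i => (n i : ℝ)‖ = ‖n‖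
    simp only [Pi.norm_def]
    rfl
  exact (hs.comp_injective hφ).congr fun n => by simp only [Function.comp_apply, hn]

theorem summable_bracket_rpow_neg {d : ℕ} {r : ℝ} (hr : (d : ℝ) < r) :
    Summable fun n : Zd d => bracket n ^ (-r) := by
  classical
  have hr0 : 0 ≤ r := (Nat.cast_nonneg d).trans hr.le
  -- Covers the origin, where `‖0‖ ^ (-r)` is `0` by convention but the weight is `1`.
  have h1 : Summable fun n : Zd d => if n = 0 then (1 : ℝ) else 0 :=
    (hasSum_ite_eq 0 1).summable
  refine Summable.of_nonneg_of_le (fun n => Real.rpow_nonneg (bracket_pos n).le _) (fun n => ?_)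
    ((summable_norm_rpow_neg hr).add h1)
  rcases eq_or_ne n 0 with rfl | hn
  · have : bracket (0 : Zd d) = 1 := by simp [bracket]
    rw [this, Real.one_rpow, if_pos rfl]
    linarith [Real.rpow_nonneg (norm_nonneg (0 : Zd d)) (-r)]
  · rw [if_neg hn, add_zero]
    exact Real.rpow_le_rpow_of_nonpos (norm_pos_iff.2 hn) (norm_le_bracket n) (by linarith)

/-! ### Free evolution and the position commutator -/

section FreeEvolution

variable {d : ℕ}

theorem laplacian_apply (u : L2 d) (n : Zd d) :
    laplacian d u n = ∑ i : Fin d, (u (n + Pi.single i 1) + u (n - Pi.single i 1)) := by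
  rw [laplacian, sum_apply, lp.coeFn_sum, Finset.sum_apply]
  rfl

theorem inner_shift_left (j : Zd d) (u v : L2 d) :
    inner ℂ (shift j u) v = inner ℂ u (shift (-j) v) := by
  rw [lp.inner_eq_tsum, lp.inner_eq_tsum,
    ← (Equiv.addRight j).tsum_eq fun n => inner ℂ (u n) (shift (-j) v n)]
  simp

theorem isSelfAdjoint_laplacian : IsSelfAdjoint (laplacian d) := by
  rw [ContinuousLinearMap.isSelfAdjoint_iff_isSymmetric]
  intro u v
  simp only [laplacian, ContinuousLinearMap.coe_coe, sum_apply, sum_inner, inner_sum,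
    add_apply, inner_add_left, inner_add_right, inner_shift_left, neg_neg]
  exact Finset.sum_congr rfl fun i _ => add_comm _ _

/-- The discrete Laplacian plus a constant. -/
def freeHamiltonian (d : ℕ) (E : ℝ) : L2 d →L[ℂ] L2 d := laplacian d + (E : ℂ) • 1

theorem isSelfAdjoint_freeHamiltonian (E : ℝ) : IsSelfAdjoint (freeHamiltonian d E) := by
  refine isSelfAdjoint_laplacian.add ?_
  have hE : IsSelfAdjoint (E : ℂ) := Complex.conj_ofReal E
  exact hE.smul (IsSelfAdjoint.one _)

theorem propagator_mem_unitary {H : L2 d →L[ℂ] L2 d} (hH : IsSelfAdjoint H) (t : ℝ) :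
    propagator H t ∈ unitary (L2 d →L[ℂ] L2 d) := by
  let _ := NormedAlgebra.restrictScalars ℚ ℂ (L2 d →L[ℂ] L2 d)
  refine NormedSpace.exp_mem_unitary_of_mem_skewAdjoint ?_
  refine hH.smul_mem_skewAdjoint ?_
  rw [skewAdjoint.mem_iff]
  simp

theorem inner_propagator {H : L2 d →L[ℂ] L2 d} (hH : IsSelfAdjoint H) (t : ℝ) (u v : L2 d) :
    inner ℂ (propagator H t u) (propagator H t v) = inner ℂ u v :=
  (ContinuousLinearMap.inner_map_map_of_mem_unitary (propagator_mem_unitary hH t) u v)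

theorem norm_propagator {H : L2 d →L[ℂ] L2 d} (hH : IsSelfAdjoint H) (t : ℝ) (u : L2 d) :
    ‖propagator H t u‖ = ‖u‖ :=
  (ContinuousLinearMap.norm_map_of_mem_unitary (propagator_mem_unitary hH t) u)

/-- The commutator of the `i`-th position operator with the discrete Laplacian. -/
def velocity (i : Fin d) : L2 d →L[ℂ] L2 d := shift (-Pi.single i 1) - shift (Pi.single i 1)

theorem shift_comm (j k : Zd d) : Commute (shift j) (shift k) := by
  ext u n
  exact congrArg u (add_right_comm n j k)

theorem velocity_comm (i : Fin d) (E : ℝ) : Commute (freeHamiltonian d E) (velocity i) := by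
  have h : ∀ j, Commute (shift j) (velocity i) := fun j =>
    (shift_comm _ _).sub_right (shift_comm _ _)
  exact (Commute.sum_left _ _ _ fun k _ => (h _).add_left (h _)).add_left
    ((Commute.one_left _).smul_left _)

/-- The commutator identity `X_i K u = K X_i u + [X_i, K] u`. As `X_i` is unbounded, a vector `z` of
`ℓ²` stands for `X_i u`. -/
theorem position_freeHamiltonian (i : Fin d) (E : ℝ) {u z : L2 d}
    (h : ∀ n, (n i : ℂ) * u n = z n) (n : Zd d) :
    (n i : ℂ) * freeHamiltonian d E u n = (freeHamiltonian d E z + velocity i u) n := by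
  have hz : ∀ w : L2 d, freeHamiltonian d E w n =
      (∑ k : Fin d, (w (n + Pi.single k 1) + w (n - Pi.single k 1))) + E * w n := fun w => by
    rw [← laplacian_apply]
    rfl
  have hv : velocity i u n = ∑ k : Fin d, if k = i then
      u (n - Pi.single i 1) - u (n + Pi.single i 1) else 0 := by
    rw [Finset.sum_ite_eq' Finset.univ i, if_pos (Finset.mem_univ i)]
    simp [velocity, sub_eq_add_neg]
  rw [lp.coeFn_add, Pi.add_apply, hz, hz, hv, mul_add, add_right_comm, ← Finset.sum_add_distrib,
    Finset.mul_sum, ← h n]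
  congr 1
  · refine Finset.sum_congr rfl fun k _ => ?_
    rw [← h, ← h]
    rcases eq_or_ne k i with rfl | hk
    · simp
      ring
    · simp [hk, hk.symm]
      ring
  · ring

/-- The value of the velocity operator at the unit vector `δ_0`. -/
def dipole (i : Fin d) : L2 d := velocity i (delta 0)

/-- Since `X_i δ_0 = 0` and the commutator commutes with `K`, each factor `K` that `X_i` passes
contributes the same term. -/
theorem position_pow (i : Fin d) (E : ℝ) (m : ℕ) (n : Zd d) :
    (n i : ℂ) * (freeHamiltonian d E ^ (m + 1)) (delta 0) n =
      ((m + 1 : ℂ) • (freeHamiltonian d E ^ m) (dipole i)) n := by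
  induction m generalizing n with
  | zero =>
    have h0 : ∀ n : Zd d, (n i : ℂ) * (delta 0 : L2 d) n = (0 : L2 d) n := fun n => by
      rcases eq_or_ne n 0 with rfl | hn
      · simp
      · simp [delta, hn]
    simpa using! position_freeHamiltonian i E h0 n
  | succ m ih =>
    have h1 := position_freeHamiltonian i E ih n
    rw [pow_succ', mul_apply_eq_comp, h1]
    refine congrArg (fun w : L2 d => w n) ?_
    have h2 := congrArg (fun T => T (delta 0)) ((velocity_comm i E).pow_left (m + 1)).eq
    simp only [mul_apply_eq_comp] at h2
    rw [← h2, map_smul, ← mul_apply_eq_comp, ← pow_succ']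
    change _ + (freeHamiltonian d E ^ (m + 1)) (dipole i) = _
    push_cast
    module

theorem hasSum_exp_apply (A : L2 d →L[ℂ] L2 d) (c : ℂ) (u : L2 d) (n : Zd d) :
    HasSum (fun m : ℕ => (m.factorial : ℂ)⁻¹ * c ^ m * (A ^ m) u n)
      (NormedSpace.exp (c • A) u n) := by
  have h := ((NormedSpace.exp_series_hasSum_exp' (𝕂 := ℂ) (c • A)).mapL
    (ContinuousLinearMap.apply ℂ (L2 d) u)).mapL (lp.evalCLM ℂ (fun _ : Zd d => ℂ) 2 n)
  convert! h using 2 with m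
  rw [smul_pow, smul_smul]
  rfl

theorem position_exp (i : Fin d) (E : ℝ) (c : ℂ) (n : Zd d) :
    (n i : ℂ) * NormedSpace.exp (c • freeHamiltonian d E) (delta 0) n =
      c * NormedSpace.exp (c • freeHamiltonian d E) (dipole i) n := by
  have h1 := (hasSum_exp_apply (freeHamiltonian d E) c (delta 0) n).mul_left (n i : ℂ)
  have h2 := (hasSum_exp_apply (freeHamiltonian d E) c (dipole i) n).mul_left c
  -- The zeroth term is `n_i δ_0(n) = 0`; after the index shift, `(m + 1) / (m + 1)! = 1 / m!`
  -- restores the exponential series.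
  have h3 := (hasSum_nat_add_iff' 1).2 h1
  have h0 : (n i : ℂ) * (delta 0 : L2 d) n = 0 := by
    rcases eq_or_ne n 0 with rfl | hn
    · simp
    · simp [delta, hn]
  simp only [Finset.sum_range_one, pow_zero, one_apply_eq_self] at h3
  rw [mul_left_comm, h0, mul_zero, sub_zero] at h3
  refine h3.unique ?_
  convert! h2 using 2 with m
  have hp := position_pow i E m n
  rw [lp.coeFn_smul, Pi.smul_apply, smul_eq_mul] at hp
  rw [mul_left_comm, hp, Nat.factorial_succ, pow_succ]
  have : (m.factorial : ℂ) ≠ 0 := by exact_mod_cast m.factorial_ne_zero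
  have : (m + 1 : ℂ) ≠ 0 := by exact_mod_cast m.succ_ne_zero
  push_cast
  field_simp

end FreeEvolution

/-! ### Weighted decay of the free evolution -/

section Dispersion

variable {d : ℕ}

theorem summable_norm_sq (u : L2 d) : Summable fun n => ‖u n‖ ^ 2 :=
  (memLp_two_iff _).1 (lp.memℓp u)

theorem norm_delta (k : Zd d) : ‖delta k‖ = 1 := by
  rw [delta, lp.norm_single (by norm_num), norm_one]

theorem rpow_le_one_add_sq {x s : ℝ} (hx : 0 ≤ x) (hs : 0 ≤ s) (hs2 : s ≤ 2) :
    x ^ s ≤ 1 + x ^ 2 := by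
  rcases le_total x 1 with h | h
  · exact (Real.rpow_le_one hx h hs).trans (by nlinarith [sq_nonneg x])
  · have := Real.rpow_le_rpow_of_exponent_le h hs2
    rw [Real.rpow_two] at this
    linarith

theorem position_propagator (i : Fin d) (E t : ℝ) (n : Zd d) :
    t * ‖propagator (freeHamiltonian d E) t (dipole i) n‖ ≤
      bracket n * ‖propagator (freeHamiltonian d E) t (delta 0) n‖ := by
  have h := congrArg norm (position_exp i E (-(Complex.I * (t : ℂ))) n)
  rw [norm_mul, norm_mul, norm_neg, norm_mul, Complex.norm_I, one_mul, Complex.norm_real] at h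
  have h1 : ‖(n i : ℂ)‖ ≤ bracket n := by
    rw [Complex.norm_intCast]
    exact (norm_le_pi_norm n i).trans (norm_le_bracket n)
  exact (mul_le_mul_of_nonneg_right (le_abs_self t) (norm_nonneg _)).trans
    (h.symm.le.trans (mul_le_mul_of_nonneg_right h1 (norm_nonneg _)))

theorem bracket_rpow_mul_propagator_le (i : Fin d) (E : ℝ) {s t : ℝ} (hs : 0 ≤ s) (hs2 : s ≤ 2)
    (ht : 0 ≤ t) (n : Zd d) :
    bracket n ^ (-s) * ‖propagator (freeHamiltonian d E) t (dipole i) n‖ ^ 2 ≤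
      (1 + t) ^ (-s) * (3 * ‖propagator (freeHamiltonian d E) t (dipole i) n‖ ^ 2 +
        2 * ‖propagator (freeHamiltonian d E) t (delta 0) n‖ ^ 2) := by
  have hp := position_propagator i E t n
  set g := ‖propagator (freeHamiltonian d E) t (dipole i) n‖
  set u := ‖propagator (freeHamiltonian d E) t (delta 0) n‖
  have hg : 0 ≤ g := norm_nonneg _
  have hB := bracket_pos n
  have hB1 := one_le_bracket n
  set B := bracket n
  have hτ : 0 < 1 + t := by linarith
  have hx := rpow_le_one_add_sq (x := (1 + t) / B) (by positivity) hs hs2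
  -- The decay rate is factored out; the remaining power is at most `1 + ((1 + t) / B) ^ 2`, so only
  -- the case `s = 2` needs the commutator.
  have hsplit : B ^ (-s) = (1 + t) ^ (-s) * ((1 + t) / B) ^ s := by
    rw [Real.div_rpow hτ.le hB.le, Real.rpow_neg hτ.le, Real.rpow_neg hB.le]
    have := (Real.rpow_pos_of_pos hτ s).ne'
    field_simp
  rw [hsplit, mul_assoc]
  refine mul_le_mul_of_nonneg_left ?_ (Real.rpow_nonneg hτ.le _)
  refine (mul_le_mul_of_nonneg_right hx (sq_nonneg g)).trans ?_
  have h2 : (t * g) ^ 2 ≤ (B * u) ^ 2 := pow_le_pow_left₀ (by positivity) hp 2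
  -- From `(1 + t)² ≤ 2 + 2t²`, `1 ≤ B` and `t g ≤ B u`.
  have h3 : ((1 + t) / B) ^ 2 * g ^ 2 ≤ 2 * g ^ 2 + 2 * u ^ 2 := by
    rw [div_pow, div_mul_eq_mul_div, div_le_iff₀ (by positivity)]
    have : 1 ≤ B ^ 2 := by nlinarith
    nlinarith [mul_nonneg (sq_nonneg (t - 1)) (sq_nonneg g),
      mul_le_mul_of_nonneg_right this (sq_nonneg g)]
  linarith

theorem positionForm_propagator_dipole_le (i : Fin d) (E : ℝ) {s t : ℝ} (hs : 0 ≤ s) (hs2 : s ≤ 2)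
    (ht : 0 ≤ t) :
    positionForm (fun n => bracket n ^ (-s)) (propagator (freeHamiltonian d E) t (dipole i)) ≤
      ENNReal.ofReal ((3 * ‖dipole i‖ ^ 2 + 2) * (1 + t) ^ (-s)) := by
  have hK := isSelfAdjoint_freeHamiltonian (d := d) E
  have h1 := (summable_norm_sq (propagator (freeHamiltonian d E) t (dipole i))).hasSum.mul_left 3
  have h2 := (summable_norm_sq (propagator (freeHamiltonian d E) t (delta 0))).hasSum.mul_left 2
  rw [← norm_sq_eq_tsum, norm_propagator hK] at h1 h2
  rw [norm_delta] at h2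
  have h3 := (h1.add h2).mul_left ((1 + t) ^ (-s))
  have hτ : 0 ≤ (1 + t) ^ (-s) := Real.rpow_nonneg (by linarith) _
  have h4 := ENNReal.ofReal_tsum_of_nonneg (fun n => by positivity) h3.summable
  rw [h3.tsum_eq] at h4
  rw [show (3 * ‖dipole i‖ ^ 2 + 2) * (1 + t) ^ (-s) =
    (1 + t) ^ (-s) * (3 * ‖dipole i‖ ^ 2 + 2 * 1 ^ 2) by ring, h4]
  exact ENNReal.tsum_le_tsum fun n =>
    ENNReal.ofReal_le_ofReal (bracket_rpow_mul_propagator_le i E hs hs2 ht n)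

theorem delta_apply_self (k : Zd d) : (delta k : L2 d) k = 1 := by simp [delta]

theorem delta_apply_ne {k n : Zd d} (h : n ≠ k) : (delta k : L2 d) n = 0 := by simp [delta, h]

theorem dipole_apply_single (i : Fin d) : dipole i (Pi.single i 1) = 1 := by
  have h : (Pi.single i 1 + Pi.single i 1 : Zd d) ≠ 0 := fun h => by
    simpa using congrFun h i
  have h' : dipole i (Pi.single i 1) = (delta 0 : L2 d) (Pi.single i 1 + -Pi.single i 1) -
    (delta 0 : L2 d) (Pi.single i 1 + Pi.single i 1) := rfl
  rw [h', add_neg_cancel, delta_apply_self, delta_apply_ne h, sub_zero]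

theorem laplacian_delta (n : Zd d) : laplacian d (delta n) =
    ∑ i : Fin d, (delta (n + Pi.single i 1) + delta (n - Pi.single i 1)) := by
  have h : ∀ j : Zd d, shift j (delta n) = delta (n - j) := fun j => by
    ext m
    rw [shift_apply]
    rcases eq_or_ne (m + j) n with rfl | hm
    · rw [add_sub_cancel_right, delta_apply_self, delta_apply_self]
    · rw [delta_apply_ne hm, delta_apply_ne fun h => hm (eq_sub_iff_add_eq.1 h)]
  simp only [laplacian, sum_apply, add_apply, h, sub_neg_eq_add]
  exact Finset.sum_congr rfl fun i _ => add_comm _ _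

end Dispersion

/-! ### The Schrödinger evolution on `ℓ¹` -/

section EllOneEvolution

variable {d : ℕ} {F : Type*} [NormedAddCommGroup F] [NormedSpace ℂ F]

/-- The Schrödinger operator with potential `V` acting on families of vectors. -/
def hop (V : Zd d → ℝ) (e : Zd d → F) (n : Zd d) : F :=
  (∑ i : Fin d, (e (n + Pi.single i 1) + e (n - Pi.single i 1))) + (V n : ℂ) • e n

theorem norm_hop_le {V : Zd d → ℝ} {B C : ℝ} (hV : ∀ n, |V n| ≤ B) {e : Zd d → F}
    (he : ∀ n, ‖e n‖ ≤ C) (n : Zd d) : ‖hop V e n‖ ≤ (∑ _i : Fin d, (C + C)) + B * C := by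
  refine (norm_add_le _ _).trans (add_le_add ((norm_sum_le _ _).trans
    (Finset.sum_le_sum fun i _ => (norm_add_le _ _).trans (add_le_add (he _) (he _)))) ?_)
  rw [norm_smul, Complex.norm_real, Real.norm_eq_abs]
  exact mul_le_mul (hV n) (he n) (norm_nonneg _) ((abs_nonneg _).trans (hV n))

theorem norm_ellOne_single (n : Zd d) : ‖lp.single (E := fun _ : Zd d => ℂ) 1 n (1 : ℂ)‖ ≤ 1 := by
  rw [lp.norm_single (by norm_num), norm_one]

/-- The Schrödinger operator on `ℓ¹(ℤ^d)`. -/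
def ellOneSchrodinger {V : Zd d → ℝ} {B : ℝ} (hV : ∀ n, |V n| ≤ B) :
    lp (fun _ : Zd d => ℂ) 1 →L[ℂ] lp (fun _ : Zd d => ℂ) 1 :=
  ellOneLift (hop V fun n => lp.single 1 n 1) (norm_hop_le hV norm_ellOne_single)

/-- The hypothesis `hA` says that the lift intertwines the `ℓ¹` operator with `A` on unit vectors,
hence everywhere. It serves twice: for the inclusion `ℓ¹ ⊂ ℓ²`, and for contraction against the sine
product. -/
theorem ellOneLift_evolution [CompleteSpace F] {V : Zd d → ℝ} {B : ℝ} (hV : ∀ n, |V n| ≤ B)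
    {e : Zd d → F} {C : ℝ} (he : ∀ n, ‖e n‖ ≤ C) {A : F →L[ℂ] F}
    (hA : ∀ n, hop V e n = A (e n)) (c : ℂ) (k : Zd d) :
    ellOneLift e he (NormedSpace.exp (c • ellOneSchrodinger hV) (lp.single 1 k 1)) =
      NormedSpace.exp (c • A) (e k) := by
  rw [exp_smul_intertwine (A := ellOneSchrodinger hV) (B := A), ellOneLift_single]
  refine ellOne_ext fun n => ?_
  rw [ContinuousLinearMap.comp_apply, ContinuousLinearMap.comp_apply, ellOneLift_single, ← hA,
    ellOneSchrodinger, ellOneLift_single]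
  simp only [hop, map_add, map_sum, map_smul, ellOneLift_single]

theorem hop_delta (V : Zd d → ℝ) (hV : ∃ B : ℝ, ∀ n, |V n| ≤ B) (n : Zd d) :
    hop V (fun n => (delta n : L2 d)) n = schrodinger V hV (delta n) := by
  rw [schrodinger, add_apply, laplacian_delta, hop]
  congr 1
  ext m
  rw [potential_apply, lp.coeFn_smul, Pi.smul_apply, smul_eq_mul]
  rcases eq_or_ne m n with rfl | h
  · rfl
  · rw [delta_apply_ne h, mul_zero, mul_zero]

theorem ellOneLift_delta_apply (u : lp (fun _ : Zd d => ℂ) 1) (n : Zd d) :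
    ellOneLift (fun n => (delta n : L2 d)) (fun n => (norm_delta n).le) u n = u n := by
  have h := (hasSum_ellOneLift (fun n => (delta n : L2 d)) (fun n => (norm_delta n).le) u).mapL
    (lp.evalCLM ℂ (fun _ : Zd d => ℂ) 2 n)
  refine h.unique ?_
  have h1 : ∀ m, lp.evalCLM ℂ (fun _ : Zd d => ℂ) 2 n (u m • (delta m : L2 d)) =
      u m * (delta m : L2 d) n := fun m => rfl
  simp only [h1]
  have h2 := hasSum_single (f := fun m => u m * (delta m : L2 d) n) n fun m hm => by
    rw [delta_apply_ne hm.symm, mul_zero]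
  rwa [delta_apply_self, mul_one] at h2

end EllOneEvolution

/-! ### The sine eigenfunction of the grid -/

section Grid

variable {m : ℕ}

/-- The product of sines that vanishes exactly on the grid. -/
def gridSine (ρ : Fin m → ℕ) (n : Zd m) : ℝ := ∏ i, Real.sin (Real.pi * n i / ρ i)

theorem abs_gridSine_le (ρ : Fin m → ℕ) (n : Zd m) : |gridSine ρ n| ≤ 1 := by
  rw [gridSine, Finset.abs_prod]
  exact Finset.prod_le_one (fun _ _ => abs_nonneg _) fun _ _ => Real.abs_sin_le_one _

theorem gridSine_eq_zero {ρ : Fin m → ℕ} (hρ : ∀ i, 2 ≤ ρ i) {n : Zd m} (hn : n ∈ grid ρ) :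
    gridSine ρ n = 0 := by
  obtain ⟨i, k, hk⟩ := mem_iUnion.1 hn
  refine Finset.prod_eq_zero (Finset.mem_univ i) ?_
  have : (ρ i : ℝ) ≠ 0 := by
    have := hρ i
    positivity
  rw [hk]
  push_cast
  rw [show Real.pi * (ρ i * k) / ρ i = k * Real.pi by field_simp]
  exact Real.sin_int_mul_pi k

theorem gridSine_one_pos {ρ : Fin m → ℕ} (hρ : ∀ i, 2 ≤ ρ i) : 0 < gridSine ρ 1 := by
  refine Finset.prod_pos fun i _ => ?_
  have h : (2 : ℝ) ≤ ρ i := by exact_mod_cast hρ i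
  rw [Pi.one_apply, Int.cast_one, mul_one]
  refine Real.sin_pos_of_pos_of_lt_pi (by positivity) ?_
  rw [div_lt_iff₀ (by linarith)]
  nlinarith [Real.pi_pos]

theorem gridSine_neighbours (ρ : Fin m → ℕ) (n : Zd m) (i : Fin m) :
    gridSine ρ (n + Pi.single i 1) + gridSine ρ (n - Pi.single i 1) =
      2 * Real.cos (Real.pi / ρ i) * gridSine ρ n := by
  have h : ∀ k : Zd m, (∀ j, j ≠ i → k j = n j) → gridSine ρ k =
      Real.sin (Real.pi * k i / ρ i) *
        ∏ j ∈ Finset.univ.erase i, Real.sin (Real.pi * n j / ρ j) := fun k hk => by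
    rw [gridSine, ← Finset.mul_prod_erase _ _ (Finset.mem_univ i)]
    congr 1
    exact Finset.prod_congr rfl fun j hj => by rw [hk j (Finset.ne_of_mem_erase hj)]
  rw [h _ fun j hj => by simp [hj], h _ fun j hj => by simp [hj], h n fun j _ => rfl, ← add_mul]
  simp only [Pi.add_apply, Pi.sub_apply, Pi.single_eq_same, Int.cast_add, Int.cast_sub,
    Int.cast_one, mul_add, mul_sub, add_div, sub_div, mul_one, Real.sin_add, Real.sin_sub]
  ring

end Grid

/-! ### Splitting the coordinates and removing the potential -/

variable {d₁ d₂ : ℕ}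

/-- The first `d₁` coordinates of a lattice point. -/
def head (n : Zd (d₁ + d₂)) : Zd d₁ := fun i => n (Fin.castAdd d₂ i)

/-- The last `d₂` coordinates of a lattice point. -/
def tail (n : Zd (d₁ + d₂)) : Zd d₂ := fun j => n (Fin.natAdd d₁ j)

theorem norm_head_le (n : Zd (d₁ + d₂)) : ‖head n‖ ≤ ‖n‖ :=
  (pi_norm_le_iff_of_nonneg (norm_nonneg n)).2 fun i => norm_le_pi_norm n (Fin.castAdd d₂ i)

theorem norm_tail_le (n : Zd (d₁ + d₂)) : ‖tail n‖ ≤ ‖n‖ :=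
  (pi_norm_le_iff_of_nonneg (norm_nonneg n)).2 fun j => norm_le_pi_norm n (Fin.natAdd d₁ j)

theorem head_single_castAdd (i : Fin d₁) :
    head (Pi.single (Fin.castAdd d₂ i) 1 : Zd (d₁ + d₂)) = Pi.single i 1 := by
  ext j
  simp [head, Pi.single_apply]

theorem tail_single_castAdd (i : Fin d₁) :
    tail (Pi.single (Fin.castAdd d₂ i) 1 : Zd (d₁ + d₂)) = 0 := by
  ext j
  simp [tail, Pi.single_apply, Fin.ext_iff]
  lia

theorem head_single_natAdd (j : Fin d₂) :
    head (Pi.single (Fin.natAdd d₁ j) 1 : Zd (d₁ + d₂)) = 0 := by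
  ext i
  simp [head, Pi.single_apply, Fin.ext_iff]
  lia

theorem tail_single_natAdd (j : Fin d₂) :
    tail (Pi.single (Fin.natAdd d₁ j) 1 : Zd (d₁ + d₂)) = Pi.single j 1 := by
  ext k
  simp [tail, Pi.single_apply]

theorem head_add (n m : Zd (d₁ + d₂)) : head (n + m) = head n + head m := rfl
theorem head_sub (n m : Zd (d₁ + d₂)) : head (n - m) = head n - head m := rfl
theorem tail_add (n m : Zd (d₁ + d₂)) : tail (n + m) = tail n + tail m := rfl
theorem tail_sub (n m : Zd (d₁ + d₂)) : tail (n - m) = tail n - tail m := rfl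

/-- The unit vectors of `ℓ²(ℤ^{d₂})` weighted by a generalized eigenfunction in the first
`d₁` coordinates. -/
def gridState (d₂ : ℕ) (ρ : Fin d₁ → ℕ) (n : Zd (d₁ + d₂)) : L2 d₂ :=
  (gridSine ρ (head n) : ℂ) • delta (tail n)

theorem norm_gridState_le (ρ : Fin d₁ → ℕ) (n : Zd (d₁ + d₂)) : ‖gridState d₂ ρ n‖ ≤ 1 := by
  rw [gridState, norm_smul, norm_delta, mul_one, Complex.norm_real]
  exact abs_gridSine_le ρ _

/-- The energy of the generalized eigenfunction `gridSine ρ`. -/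
def gridEnergy (ρ : Fin d₁ → ℕ) : ℝ := ∑ i, 2 * Real.cos (Real.pi / ρ i)

/-- The potential drops out at every site: on `Γ` the sine product is zero, off `Γ` the potential
is. The first `d₁` directions then give the eigenvalue, the others the Laplacian. -/
theorem hop_gridState {ρ : Fin d₁ → ℕ} (hρ : ∀ i, 2 ≤ ρ i) {V : Zd (d₁ + d₂) → ℝ}
    (hΓ : IsTrimmed (gridSet d₂ ρ) V) (n : Zd (d₁ + d₂)) :
    hop V (gridState d₂ ρ) n = freeHamiltonian d₂ (gridEnergy ρ) (gridState d₂ ρ n) := by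
  have hV : (V n : ℂ) • gridState d₂ ρ n = 0 := by
    by_cases hn : n ∈ gridSet d₂ ρ
    · rw [gridState, show gridSine ρ (head n) = 0 from gridSine_eq_zero hρ hn, Complex.ofReal_zero,
        zero_smul, smul_zero]
    · rw [hΓ n hn, Complex.ofReal_zero, zero_smul]
  have h1 : ∀ i : Fin d₁, gridState d₂ ρ (n + Pi.single (Fin.castAdd d₂ i) 1) +
      gridState d₂ ρ (n - Pi.single (Fin.castAdd d₂ i) 1) =
      ((2 * Real.cos (Real.pi / ρ i) : ℝ) : ℂ) • gridState d₂ ρ n := fun i => by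
    simp only [gridState, head_add, head_sub, tail_add, tail_sub, head_single_castAdd,
      tail_single_castAdd, add_zero, sub_zero]
    rw [← add_smul, ← Complex.ofReal_add, gridSine_neighbours, Complex.ofReal_mul, mul_smul]
  have h2 : ∀ j : Fin d₂, gridState d₂ ρ (n + Pi.single (Fin.natAdd d₁ j) 1) +
      gridState d₂ ρ (n - Pi.single (Fin.natAdd d₁ j) 1) =
      (gridSine ρ (head n) : ℂ) •
        (delta (tail n + Pi.single j 1) + delta (tail n - Pi.single j 1)) := fun j => by
    simp only [gridState, head_add, head_sub, tail_add, tail_sub, head_single_natAdd,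
      tail_single_natAdd, add_zero, sub_zero, smul_add]
  rw [hop, hV, add_zero, Fin.sum_univ_add]
  simp only [h1, h2]
  rw [← Finset.smul_sum, ← laplacian_delta, ← Finset.sum_smul, ← Complex.ofReal_sum,
    ← map_smul (laplacian d₂), add_comm]
  rfl

/-- Both `⟨head n⟩` and `⟨tail n⟩` are at most `⟨n⟩`, so the weight splits as `⟨n⟩^{-q} ≤ ⟨head
n⟩^{-r} ⟨tail n⟩^{-s}` and the sum factors. -/
theorem tsum_bracket_rpow_tail_le {q r s : ℝ} (hr : 0 ≤ r) (hs : 0 ≤ s) (hq : q = r + s)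
    (g : L2 d₂) :
    ∑' n : Zd (d₁ + d₂), ENNReal.ofReal (bracket n ^ (-q) * ‖g (tail n)‖ ^ 2) ≤
      (∑' a : Zd d₁, ENNReal.ofReal (bracket a ^ (-r))) *
        positionForm (fun n => bracket n ^ (-s)) g := by
  have key : ∀ n : Zd (d₁ + d₂), ENNReal.ofReal (bracket n ^ (-q) * ‖g (tail n)‖ ^ 2) ≤
      ENNReal.ofReal (bracket (head n) ^ (-r)) *
        ENNReal.ofReal (bracket (tail n) ^ (-s) * ‖g (tail n)‖ ^ 2) := fun n => by
    have h1 := Real.rpow_nonneg (bracket_pos (head n)).le (-r)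
    rw [← ENNReal.ofReal_mul h1, ← mul_assoc]
    refine ENNReal.ofReal_le_ofReal (mul_le_mul_of_nonneg_right ?_ (sq_nonneg _))
    rw [hq, neg_add, Real.rpow_add (bracket_pos n)]
    exact mul_le_mul
      (Real.rpow_le_rpow_of_nonpos (bracket_pos _) (bracket_mono (norm_head_le n)) (by linarith))
      (Real.rpow_le_rpow_of_nonpos (bracket_pos _) (bracket_mono (norm_tail_le n)) (by linarith))
      (Real.rpow_nonneg (bracket_pos n).le _) h1
  refine (ENNReal.tsum_le_tsum key).trans (le_of_eq ?_)
  rw [← (Fin.appendEquiv d₁ d₂).tsum_eq, ENNReal.tsum_prod', ← ENNReal.tsum_mul_right]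
  refine tsum_congr fun a => ?_
  rw [positionForm, ← ENNReal.tsum_mul_left]
  refine tsum_congr fun b => ?_
  have ha : head (Fin.appendEquiv d₁ d₂ (a, b)) = a := funext fun i => Fin.append_left a b i
  have hb : tail (Fin.appendEquiv d₁ d₂ (a, b)) = b := funext fun i => Fin.append_right a b i
  rw [ha, hb]

/-! ### The conserved overlap and growth of moments -/

/-- The starting point `(1, …, 1; e_j)`. -/
def startPoint (d₁ : ℕ) (j : Fin d₂) : Zd (d₁ + d₂) := Fin.append 1 (Pi.single j 1)

theorem head_startPoint (j : Fin d₂) : head (startPoint d₁ j) = 1 :=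
  funext fun i => Fin.append_left _ _ i

theorem tail_startPoint (j : Fin d₂) : tail (startPoint d₁ j) = Pi.single j 1 :=
  funext fun i => Fin.append_right _ _ i

theorem startPoint_notMem {ρ : Fin d₁ → ℕ} (hρ : ∀ i, 2 ≤ ρ i) (j : Fin d₂) :
    startPoint d₁ j ∉ gridSet d₂ ρ := fun h => by
  have h0 := gridSine_eq_zero hρ h
  have h1 := gridSine_one_pos hρ
  rw [← head_startPoint j] at h1
  exact h1.ne' h0

/-- Contraction sends `e^{-itH} δ_{n₀}` to `e^{-itK}` applied to a multiple of `δ_{e_j}`; by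
unitarity its pairing with `e^{-itK}` of the dipole keeps its value at time `0`. -/
theorem hasSum_overlap {ρ : Fin d₁ → ℕ} (hρ : ∀ i, 2 ≤ ρ i) {V : Zd (d₁ + d₂) → ℝ}
    (hV : ∃ B : ℝ, ∀ n, |V n| ≤ B) (hΓ : IsTrimmed (gridSet d₂ ρ) V) (j : Fin d₂) (t : ℝ) :
    HasSum (fun n => (propagator (schrodinger V hV) t (delta (startPoint d₁ j)) n *
        gridSine ρ (head n)) *
        (starRingEnd ℂ) (propagator (freeHamiltonian d₂ (gridEnergy ρ)) t (dipole j) (tail n)))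
      (gridSine ρ 1 : ℂ) := by
  obtain ⟨B, hB⟩ := id hV
  set c : ℂ := -(Complex.I * (t : ℂ)) with hc
  set k := startPoint d₁ j
  set g := propagator (freeHamiltonian d₂ (gridEnergy ρ)) t (dipole j) with hg
  let u := NormedSpace.exp (c • ellOneSchrodinger hB) (lp.single 1 k 1)
  have h1 : ∀ n, u n = propagator (schrodinger V hV) t (delta k) n := fun n => by
    rw [← ellOneLift_delta_apply u n, ellOneLift_evolution hB _ (hop_delta V hV), propagator]
  have h2 : ellOneLift (gridState d₂ ρ) (norm_gridState_le ρ) u =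
      propagator (freeHamiltonian d₂ (gridEnergy ρ)) t (gridState d₂ ρ k) :=
    ellOneLift_evolution hB _ (hop_gridState hρ hΓ) c k
  have h3 := (hasSum_ellOneLift (gridState d₂ ρ) (norm_gridState_le ρ) u).mapL (innerSL ℂ g)
  have hd : ∀ (w : L2 d₂) (m : Zd d₂), inner ℂ w (delta m) = (starRingEnd ℂ) (w m) :=
    fun w m => by
      rw [delta, lp.inner_single_right]
      simp
  rw [h2, innerSL_apply_apply, hg, inner_propagator (isSelfAdjoint_freeHamiltonian _), gridState,
    head_startPoint, tail_startPoint, inner_smul_right, hd, dipole_apply_single, map_one,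
    mul_one, ← hg] at h3
  convert! h3 using 2 with n
  rw [innerSL_apply_apply, inner_smul_right, gridState, inner_smul_right, hd, h1, mul_assoc]

theorem exists_rpow_le_positionForm {ρ : Fin d₁ → ℕ} (hρ : ∀ i, 2 ≤ ρ i) {V : Zd (d₁ + d₂) → ℝ}
    (hV : ∃ B : ℝ, ∀ n, |V n| ≤ B) (hΓ : IsTrimmed (gridSet d₂ ρ) V) (j : Fin d₂) {q s : ℝ}
    (hs : 0 ≤ s) (hs2 : s ≤ 2) (hq : d₁ + s < q) :
    ∃ c : ℝ, 0 < c ∧ ∀ t : ℝ, 0 ≤ t → ENNReal.ofReal (c * (1 + t) ^ s) ≤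
      positionForm (fun n => bracket n ^ q)
        (propagator (schrodinger V hV) t (delta (startPoint d₁ j))) := by
  have hr : (d₁ : ℝ) < q - s := by linarith
  have hr0 : 0 ≤ q - s := (Nat.cast_nonneg d₁).trans hr.le
  have hsum := summable_bracket_rpow_neg hr
  have hnn : ∀ a : Zd d₁, 0 ≤ bracket a ^ (-(q - s)) := fun a =>
    Real.rpow_nonneg (bracket_pos a).le _
  set S := ∑' a : Zd d₁, bracket a ^ (-(q - s)) with hS
  have hS0 : 0 ≤ S := tsum_nonneg hnn
  set b := gridSine ρ 1
  have hb : 0 < b := gridSine_one_pos hρ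
  set N := 3 * ‖dipole j‖ ^ 2 + 2
  have hN : 0 < N := by positivity
  set D := (S + 1) * N
  have hD : 0 < D := by positivity
  refine ⟨b ^ 2 / (4 * D), by positivity, fun t ht => ?_⟩
  set τ := (1 + t) ^ s with hτ
  have hτ0 : 0 < τ := Real.rpow_pos_of_pos (by linarith) s
  have hτn : (1 + t) ^ (-s) = τ⁻¹ := Real.rpow_neg (by linarith) s
  set u := propagator (schrodinger V hV) t (delta (startPoint d₁ j)) with hu
  set g := propagator (freeHamiltonian d₂ (gridEnergy ρ)) t (dipole j) with hg
  have hov := hasSum_overlap hρ hV hΓ j t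
  rw [← hu, ← hg] at hov
  -- Chosen so that the second Young term sums to at most `l⁻¹ D τ⁻¹ = b / 2`, half of the overlap;
  -- what is left gives the moment at least `b / (2 l) = b² τ / (4 D)`.
  set l := 2 * D * τ⁻¹ / b with hl
  have hl0 : 0 < l := by positivity
  -- Young's inequality termwise, in `ℝ≥0∞`, so that the moment is allowed to be infinite.
  have hyoung : ∀ n, ‖u n * gridSine ρ (head n) * (starRingEnd ℂ) (g (tail n))‖ₑ ≤
      ENNReal.ofReal l * ENNReal.ofReal (bracket n ^ q * ‖u n‖ ^ 2) +
        ENNReal.ofReal l⁻¹ * ENNReal.ofReal (bracket n ^ (-q) * ‖g (tail n)‖ ^ 2) := fun n => by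
    have hp := Real.rpow_pos_of_pos (bracket_pos n) q
    rw [← ENNReal.ofReal_mul hl0.le, ← ENNReal.ofReal_mul (by positivity),
      Real.rpow_neg (bracket_pos n).le, ← ENNReal.ofReal_add (by positivity) (by positivity),
      ← ofReal_norm]
    refine ENNReal.ofReal_le_ofReal ?_
    rw [norm_mul, norm_mul, RCLike.norm_conj, Complex.norm_real, Real.norm_eq_abs]
    set p := bracket n ^ q
    set x := ‖u n‖
    set y := ‖g (tail n)‖
    have hx : 0 ≤ x := norm_nonneg _
    have hy : 0 ≤ y := norm_nonneg _
    have h1 : x * |gridSine ρ (head n)| * y ≤ x * y :=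
      mul_le_mul_of_nonneg_right (mul_le_of_le_one_right hx (abs_gridSine_le ρ _)) hy
    have h2 : l * (p * x ^ 2) + l⁻¹ * (p⁻¹ * y ^ 2) - 2 * (x * y) =
        (l * p)⁻¹ * (l * p * x - y) ^ 2 := by
      field_simp
      ring
    have h3 : 0 ≤ (l * p)⁻¹ * (l * p * x - y) ^ 2 := by positivity
    nlinarith [mul_nonneg hx hy]
  have hW : ∑' n : Zd (d₁ + d₂), ENNReal.ofReal (bracket n ^ (-q) * ‖g (tail n)‖ ^ 2) ≤
      ENNReal.ofReal (D * τ⁻¹) := by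
    refine (tsum_bracket_rpow_tail_le hr0 hs (by ring) g).trans ?_
    rw [← ENNReal.ofReal_tsum_of_nonneg hnn hsum, ← hS]
    refine (mul_le_mul_right (positionForm_propagator_dipole_le j _ hs hs2 ht) _).trans ?_
    rw [← ENNReal.ofReal_mul hS0, hτn, ← mul_assoc]
    refine ENNReal.ofReal_le_ofReal ?_
    gcongr
    linarith
  have hmain : ENNReal.ofReal (b / 2) + ENNReal.ofReal (b / 2) ≤
      ENNReal.ofReal l * positionForm (fun n => bracket n ^ q) u + ENNReal.ofReal (b / 2) := by
    rw [← ENNReal.ofReal_add (by positivity) (by positivity), add_halves]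
    have h1 : ENNReal.ofReal b ≤ ∑' n, ‖u n * gridSine ρ (head n) *
        (starRingEnd ℂ) (g (tail n))‖ₑ := by
      have h2 := enorm_tsum_le_tsum_enorm (f := fun n => u n * gridSine ρ (head n) *
        (starRingEnd ℂ) (g (tail n)))
      rwa [hov.tsum_eq, ← ofReal_norm, Complex.norm_real, Real.norm_of_nonneg hb.le] at h2
    refine h1.trans ((ENNReal.tsum_le_tsum hyoung).trans ?_)
    rw [ENNReal.tsum_add, ENNReal.tsum_mul_left, ENNReal.tsum_mul_left]
    refine add_le_add le_rfl ((mul_le_mul_right hW _).trans ?_)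
    rw [← ENNReal.ofReal_mul (by positivity)]
    refine ENNReal.ofReal_le_ofReal (le_of_eq ?_)
    rw [hl]
    field_simp
  have hfin := ENNReal.le_of_add_le_add_right ENNReal.ofReal_ne_top hmain
  replace hfin := ENNReal.div_le_of_le_mul' hfin
  rw [← ENNReal.ofReal_div_of_pos hl0] at hfin
  refine le_trans (le_of_eq (congrArg ENNReal.ofReal ?_)) hfin
  rw [hl]
  field_simp
  ring

/-! ### Time averaging -/

theorem exists_rpow_le_transport {d : ℕ} {H : L2 d →L[ℂ] L2 d} {φ : Zd d → ℝ} {k : Zd d}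
    {c s : ℝ} (hs : 0 ≤ s) (hc : 0 < c) (h : ∀ t : ℝ, 0 ≤ t →
      ENNReal.ofReal (c * (1 + t) ^ s) ≤ positionForm φ (propagator H t (delta k))) :
    ∃ C : ℝ, 0 < C ∧ ∀ T : ℝ, 0 < T → ENNReal.ofReal (C * T ^ s) ≤ transport H φ k T := by
  refine ⟨Real.exp (-2) * c, by positivity, fun T hT => ?_⟩
  have hTs := Real.rpow_nonneg hT.le s
  -- On this window of length `T` the exponential weight is at least `e^{-2}`, and `(1 + t)^s ≥
  -- T^s`.
  have h1 : ∀ t ∈ Ioc T (2 * T), ENNReal.ofReal (Real.exp (-2) * c * T ^ s) ≤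
      ENNReal.ofReal (Real.exp (-t / T)) * positionForm φ (propagator H t (delta k)) := by
    intro t ht
    have ht0 : 0 ≤ t := hT.le.trans ht.1.le
    refine le_trans ?_ (mul_le_mul_right (h t ht0) _)
    rw [← ENNReal.ofReal_mul (Real.exp_pos _).le, mul_assoc]
    refine ENNReal.ofReal_le_ofReal ?_
    gcongr
    · rw [le_div_iff₀ hT]
      linarith [ht.2]
    · linarith [ht.1]
  have h2 : ENNReal.ofReal (Real.exp (-2) * c * T ^ s) * ENNReal.ofReal T ≤
      ∫⁻ t in Ioi (0 : ℝ), ENNReal.ofReal (Real.exp (-t / T)) *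
        positionForm φ (propagator H t (delta k)) := by
    refine le_trans (le_of_eq ?_) ((setLIntegral_mono' (measurableSet_Ioc (a := T) (b := 2 * T))
      h1).trans (lintegral_mono_set fun t ht => hT.trans ht.1))
    rw [setLIntegral_const, Real.volume_Ioc]
    congr 2
    ring
  refine le_trans (le_of_eq ?_) (mul_le_mul_right h2 _)
  rw [← ENNReal.ofReal_mul (by positivity), ← ENNReal.ofReal_mul (by positivity)]
  congr 1
  field_simp

end TrimmedSchrodinger

end

theorem theorem5p4 (d₁ d₂ : ℕ) (hd₂ : 2 ≤ d₂) (ρ : Fin d₁ → ℕ) (hρ : ∀ i, 2 ≤ ρ i)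
    (V : TrimmedSchrodinger.Zd (d₁ + d₂) → ℝ) (hV : ∃ B : ℝ, ∀ n, |V n| ≤ B)
    (hΓ : TrimmedSchrodinger.IsTrimmed (TrimmedSchrodinger.gridSet d₂ ρ) V) :
    ∃ n₀ ∈ (TrimmedSchrodinger.gridSet d₂ ρ)ᶜ,
      (∀ q : ℝ, (d₁ : ℝ) + 1 < q → ∃ C : ℝ, 0 < C ∧ ∀ T : ℝ, 0 < T →
        ENNReal.ofReal (C * T) ≤
          TrimmedSchrodinger.moment (TrimmedSchrodinger.schrodinger V hV) q n₀ T) ∧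
      (∀ q : ℝ, (d₁ : ℝ) < q → q < (d₁ : ℝ) + 1 →
        ∀ ε : ℝ, 0 < ε → ε < q - (d₁ : ℝ) → ∃ C : ℝ, 0 < C ∧ ∀ T : ℝ, 0 < T →
          ENNReal.ofReal (C * T ^ (q - (d₁ : ℝ) - ε)) ≤
            TrimmedSchrodinger.moment (TrimmedSchrodinger.schrodinger V hV) q n₀ T) := by
  let j : Fin d₂ := ⟨0, by lia⟩
  refine ⟨TrimmedSchrodinger.startPoint d₁ j, TrimmedSchrodinger.startPoint_notMem hρ j,
    fun q hq => ?_, fun q _ hq1 ε hε hεq => ?_⟩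
  -- With `s = 1` the requirement `d₁ + s < q` is the hypothesis on `q`; in the second case `s = q -
  -- d₁ - ε` leaves a margin of `ε`.
  · obtain ⟨c, hc, h⟩ := TrimmedSchrodinger.exists_rpow_le_positionForm hρ hV hΓ j (q := q) (s := 1)
      zero_le_one one_le_two hq
    simpa only [Real.rpow_one] using!
      TrimmedSchrodinger.exists_rpow_le_transport zero_le_one hc h
  · have hs : 0 ≤ q - (d₁ : ℝ) - ε := by linarith
    obtain ⟨c, hc, h⟩ := TrimmedSchrodinger.exists_rpow_le_positionForm hρ hV hΓ j (q := q) hs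
      (by linarith) (by linarith)
    exact TrimmedSchrodinger.exists_rpow_le_transport hs hc h
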